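/- Let $m\ge 3$ be an integer and let $G=K_m\square K_2$ be the cartesian product of the complete graphs on $m$ and $2$ vertices: its vertices are the pairs $(u,u')\in V(K_m)\times V(K_2)$, and $(u,u')$, $(v,v')$ are adjacent if and only if either $u=v$ and $u'\neq v'$, or $u'=v'$ and $u\ne v$. Let $\Delta_G$ be the independence complex of $G$, that is, the simplicial complex whose faces are the independent sets of vertices of $G$. Then: 1. $G$ is unmixed: all maximal independent sets of vertices of $G$ have the same size (that is, $\Delta_G$ is pure). 2. $G$ is vertex decomposable: $\Delta_G$ is vertex decomposable. Here a simplicial complex $\Delta$ is, recursively, vertex decomposable if it is a simplex (possibly $\{\emptyset\}$), or if it has a vertex $v$ such that the deletion $\Delta\setminus v=\{F\in\Delta: v\notin F\}$ and the link $\mathrm{link}_\Delta v=\{F: v\notin F,\ F\cup\{v\}\in\Delta\}$ are both vertex decomposable and no face of $\mathrm{link}_\Delta v$ is a facet of $\Delta\setminus v$. 3. Consequently $G$ is Cohen–Macaulay over every field $k$: the Stanley–Reisner ring $k[\Delta_G]=k[x_v : v\in V(G)]/\big(\prod_{v\in F}x_v : F\notin\Delta_G\big)$ is a Cohen–Macaulay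 ring, that is, it is Noetherian and each of its localizations at a prime ideal has depth equal to its Krull dimension. -/

import Mathlib

/-- An abstract simplicial complex on (a subset of) the ground set `V`, given by its finite faces.
Unlike in `AbstractSimplicialComplex`, the empty set is a face, and an element of `V` need not be
a vertex; this is the convention in which links and deletions stay on the same ground set. -/
@[ext]
structure FaceComplex (V : Type*) where
  /-- The faces of the complex. -/
  faces : Set (Finset V)
  empty_mem : ∅ ∈ faces
  down_closed : ∀ s ∈ faces, ∀ t, t ⊆ s → t ∈ faces

namespace FaceComplex

variable {V : Type*}

/-- A facet is a face that is maximal under inclusion. -/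
def IsFacet (D : FaceComplex V) (F : Finset V) : Prop :=
  Maximal (fun s => s ∈ D.faces) F

/-- A complex is pure if all its facets have the same cardinality. -/
def IsPure (D : FaceComplex V) : Prop :=
  ∀ F F' : Finset V, D.IsFacet F → D.IsFacet F' → F.card = F'.card

/-- A complex is a simplex if its faces are all the subsets of one finite set
(the complex whose only face is `∅` is a simplex). -/
def IsSimplex (D : FaceComplex V) : Prop :=
  ∃ s : Finset V, ∀ t : Finset V, t ∈ D.faces ↔ t ⊆ s

/-- The deletion of `v`: the faces that do not contain `v`. -/
def deletion (D : FaceComplex V) (v : V) : FaceComplex V where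
  faces := {s | s ∈ D.faces ∧ v ∉ s}
  empty_mem := ⟨D.empty_mem, by simp⟩
  down_closed := fun s hs t hts => ⟨D.down_closed s hs.1 t hts, fun h => hs.2 (hts h)⟩

/-- The link of a vertex `v`: the sets `s` not containing `v` such that `s ∪ {v}` is a face. -/
def link [DecidableEq V] (D : FaceComplex V) (v : V) (hv : {v} ∈ D.faces) : FaceComplex V where
  faces := {s | v ∉ s ∧ insert v s ∈ D.faces}
  empty_mem := ⟨by simp, by simpa using hv⟩
  down_closed := fun s hs t hts =>
    ⟨fun h => hs.1 (hts h), D.down_closed _ hs.2 _ (Finset.insert_subset_insert v hts)⟩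

/-- Vertex decomposability (not necessarily pure): a complex is vertex decomposable if it is a
simplex, or if it has a vertex `v` whose deletion and link are both vertex decomposable and which
is a shedding vertex, i.e. no face of the link of `v` is a facet of the deletion of `v`. -/
inductive VertexDecomposable [DecidableEq V] : FaceComplex V → Prop
  | of_isSimplex (D : FaceComplex V) (h : D.IsSimplex) : VertexDecomposable D
  | of_shedding (D : FaceComplex V) (v : V) (hv : {v} ∈ D.faces)
      (hdel : VertexDecomposable (D.deletion v))
      (hlink : VertexDecomposable (D.link v hv))
      (hshed : ∀ F ∈ (D.link v hv).faces, ¬ (D.deletion v).IsFacet F) : VertexDecomposable D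

open MvPolynomial in
/-- The Stanley–Reisner ideal: generated by the squarefree monomials of the nonfaces. -/
noncomputable def stanleyReisnerIdeal (k : Type*) [Field k] (D : FaceComplex V) : Ideal (MvPolynomial V k) :=
  Ideal.span {f | ∃ s : Finset V, s ∉ D.faces ∧ f = ∏ i ∈ s, X i}

/-- The Stanley–Reisner ring `k[Δ]`. -/
abbrev StanleyReisnerRing (k : Type*) [Field k] (D : FaceComplex V) : Type _ :=
  MvPolynomial V k ⧸ D.stanleyReisnerIdeal k

end FaceComplex

/-- The depth of a (Noetherian) local ring: the supremum of the lengths of the regular sequences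
in its maximal ideal. -/
noncomputable def localRingDepth (R : Type*) [CommRing R] [IsLocalRing R] : ℕ∞ :=
  sSup {n : ℕ∞ | ∃ rs : List R, (∀ r ∈ rs, r ∈ IsLocalRing.maximalIdeal R) ∧
    RingTheory.Sequence.IsRegular R rs ∧ n = (rs.length : ℕ∞)}

/-- A commutative ring is Cohen–Macaulay if it is Noetherian and each of its localizations at a
prime has depth equal to its Krull dimension. -/
def IsCohenMacaulayRing (R : Type*) [CommRing R] : Prop :=
  IsNoetherianRing R ∧ ∀ (P : Ideal R) [P.IsPrime],
    (localRingDepth (Localization.AtPrime P) : WithBot ℕ∞) = ringKrullDim (Localization.AtPrime P)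

namespace SimpleGraph

variable {V : Type*}

/-- The independence complex of a graph: its faces are the independent sets of vertices. -/
def independenceComplex (G : SimpleGraph V) : FaceComplex V where
  faces := {s | G.IsIndepSet (s : Set V)}
  empty_mem := by simp [SimpleGraph.IsIndepSet]
  down_closed := fun _ hs _ hts => Set.Pairwise.mono (Finset.coe_subset.2 hts) hs

/-- A finite graph is unmixed if all its maximal independent sets have the same size,
i.e. if its independence complex is pure. -/
def IsUnmixed (G : SimpleGraph V) : Prop := G.independenceComplex.IsPure

/-- A finite graph is vertex decomposable if its independence complex is. -/
def IsVertexDecomposable [DecidableEq V] (G : SimpleGraph V) : Prop :=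
  G.independenceComplex.VertexDecomposable

/-- A finite graph is Cohen–Macaulay over the field `k` if the Stanley–Reisner ring over `k` of its
independence complex is a Cohen–Macaulay ring. -/
def IsCohenMacaulay (k : Type*) [Field k] (G : SimpleGraph V) : Prop :=
  IsCohenMacaulayRing (G.independenceComplex.StanleyReisnerRing k)

end SimpleGraph

/-! The independence complex is one-dimensional: its facets are the pairs `{(p, 0), (q, 1)}` with `p
≠ q` (`mem_faces_completePrism_iff`), so purity is immediate. For vertex decomposability, vertices
are removed one at a time until a single edge is left. Every link is a set of isolated points, so
only the shedding condition needs care (`vertexDecomposable_induced_of_erase`). Cohen–Macaulayness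
is proved directly, without vertex decomposability. The Stanley–Reisner ring `R` is integral over `A
= k[s, t]`, with `s`, `t` the sums of the variables over the two copies of `K_m`. It embeds in the
product of one copy of `A` per facet, as the families agreeing along common vertices
(`exists_restrict_eq`). This description yields regular sequences from `A` of length at least the
height of each prime of `R`, as packaged in `isCohenMacaulayRing_of_isIntegral`. -/

namespace FaceComplex

variable {V : Type*}

/-- The complex whose faces are the subsets of `N` with at most one element. -/
def points (N : Finset V) : FaceComplex V where
  faces := {s | s ⊆ N ∧ s.card ≤ 1}
  empty_mem := by simp
  down_closed := fun _ hs _ hts => ⟨hts.trans hs.1, (Finset.card_le_card hts).trans hs.2⟩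

theorem points_vertexDecomposable [DecidableEq V] (N : Finset V) :
    (points N).VertexDecomposable := by
  induction N using Finset.induction_on with
  | empty =>
    refine .of_isSimplex _ ⟨∅, fun t => ?_⟩
    simp only [points, Set.mem_ofPred_eq, Finset.subset_empty, and_iff_left_iff_imp]
    rintro rfl
    simp
  | insert a N ha ih =>
    rcases N.eq_empty_or_nonempty with rfl | ⟨b, hb⟩
    · refine .of_isSimplex _ ⟨{a}, fun t => ?_⟩
      simp only [points, Set.mem_ofPred_eq, insert_empty_eq, and_iff_left_iff_imp]
      intro ht
      simpa using Finset.card_le_card ht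
    have hv : {a} ∈ (points (insert a N)).faces := by simp [points]
    have hdel : (points (insert a N)).deletion a = points N := by
      ext t
      simp only [deletion, points, Set.mem_ofPred_eq]
      constructor
      · rintro ⟨⟨h1, h2⟩, h3⟩
        exact ⟨(Finset.subset_insert_iff_of_notMem h3).1 h1, h2⟩
      · rintro ⟨h1, h2⟩
        exact ⟨⟨h1.trans (Finset.subset_insert _ _), h2⟩, fun h => ha (h1 h)⟩
    have hlink : ∀ F ∈ ((points (insert a N)).link a hv).faces, F = ∅ := by
      rintro F ⟨h1, -, h2⟩
      rw [Finset.card_insert_of_notMem h1] at h2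
      exact Finset.card_eq_zero.1 (by omega)
    refine .of_shedding _ a hv (hdel ▸ ih) (.of_isSimplex _ ⟨∅, fun t => ?_⟩) ?_
    · refine ⟨fun h => by simp [hlink t h], fun h => ?_⟩
      rw [Finset.subset_empty.1 h]
      exact empty_mem _
    · intro F hF hmax
      rw [hlink F hF, hdel] at hmax
      have := hmax.2 (y := {b}) (by simp [points, hb]) (by simp)
      simpa using this (Finset.mem_singleton_self b)

/-- The subcomplex of the faces contained in `W`. -/
def induced (D : FaceComplex V) (W : Finset V) : FaceComplex V where
  faces := {s | s ∈ D.faces ∧ s ⊆ W}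
  empty_mem := ⟨D.empty_mem, Finset.empty_subset _⟩
  down_closed := fun s hs t hts => ⟨D.down_closed s hs.1 t hts, hts.trans hs.2⟩

theorem induced_univ [Fintype V] (D : FaceComplex V) : D.induced Finset.univ = D := by
  ext s
  simp [induced]

theorem deletion_induced [DecidableEq V] (D : FaceComplex V) (W : Finset V) (v : V) :
    (D.induced W).deletion v = D.induced (W.erase v) := by
  ext s
  simp [induced, deletion, Finset.subset_erase, and_assoc]

end FaceComplex

/-! ### Faces of the prism's complex; purity and vertex decomposability. -/

namespace SimpleGraph

variable {m : ℕ}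

/-- The graph `K_m □ K_2`. -/
abbrev completePrism (m : ℕ) : SimpleGraph (Fin m × Fin 2) :=
  completeGraph (Fin m) □ completeGraph (Fin 2)

/-- The pair of vertices `(p, 0)`, `(q, 1)` of the prism. -/
def transversal (p q : Fin m) : Finset (Fin m × Fin 2) := {(p, 0), (q, 1)}

theorem pair_mem_faces_completePrism {a b : Fin m × Fin 2} (h₁ : a.1 ≠ b.1) (h₂ : a.2 ≠ b.2) :
    {a, b} ∈ (completePrism m).independenceComplex.faces := by
  have key : ¬ (completePrism m).Adj a b := by
    simp [completeGraph, boxProd_adj, h₁, h₂]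
  intro x hx y hy hxy
  simp only [Finset.coe_insert, Finset.coe_singleton, Set.mem_insert_iff,
    Set.mem_singleton_iff] at hx hy
  rcases hx with rfl | rfl <;> rcases hy with rfl | rfl
  · exact absurd rfl hxy
  · exact key
  · exact fun h => key h.symm
  · exact absurd rfl hxy

theorem ne_and_ne_of_mem_faces_completePrism {s : Finset (Fin m × Fin 2)}
    (hs : s ∈ (completePrism m).independenceComplex.faces) {a b : Fin m × Fin 2}
    (ha : a ∈ s) (hb : b ∈ s) (hab : a ≠ b) : a.1 ≠ b.1 ∧ a.2 ≠ b.2 := by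
  have hadj : ¬ (completePrism m).Adj a b := hs ha hb hab
  obtain ⟨a, i⟩ := a
  obtain ⟨b, j⟩ := b
  simp only [boxProd_adj, top_adj, completeGraph] at hadj
  simp only [ne_eq, Prod.mk.injEq] at hab
  tauto

/-- An independent set has at most one vertex in each copy of `K_m`; a missing one is supplied by
any vertex off the matching edge. -/
theorem mem_faces_completePrism_iff (hm : 3 ≤ m) {s : Finset (Fin m × Fin 2)} :
    s ∈ (completePrism m).independenceComplex.faces ↔ ∃ p q, p ≠ q ∧ s ⊆ transversal p q := by
  have third : ∀ a : Fin m, ∃ b, b ≠ a := fun a => by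
    have : Nontrivial (Fin m) := Fin.nontrivial_iff_two_le.2 (by omega)
    exact exists_ne a
  constructor
  · intro hs
    have hs' : ∀ a ∈ s, ∀ b ∈ s, a ≠ b → a.1 ≠ b.1 ∧ a.2 ≠ b.2 := fun a ha b hb hab =>
      ne_and_ne_of_mem_faces_completePrism hs ha hb hab
    by_cases h0 : ∃ p, (p, (0 : Fin 2)) ∈ s <;> by_cases h1 : ∃ q, (q, (1 : Fin 2)) ∈ s
    · obtain ⟨p, hp⟩ := h0
      obtain ⟨q, hq⟩ := h1
      refine ⟨p, q, (hs' _ hp _ hq (by simp)).1, ?_⟩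
      rintro ⟨a, i⟩ ha
      have h2 := hs' _ ha _ hp
      have h3 := hs' _ ha _ hq
      fin_cases i <;> simp_all [transversal]
    · obtain ⟨p, hp⟩ := h0
      obtain ⟨q, hq⟩ := third p
      refine ⟨p, q, hq.symm, ?_⟩
      rintro ⟨a, i⟩ ha
      have h2 := hs' _ ha _ hp
      fin_cases i <;> simp_all [transversal]
    · obtain ⟨q, hq⟩ := h1
      obtain ⟨p, hp⟩ := third q
      refine ⟨p, q, hp, ?_⟩
      rintro ⟨a, i⟩ ha
      have h3 := hs' _ ha _ hq
      fin_cases i <;> simp_all [transversal]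
    · obtain ⟨q, hq⟩ := third ⟨0, by omega⟩
      refine ⟨_, q, hq.symm, ?_⟩
      rintro ⟨a, i⟩ ha
      fin_cases i <;> simp_all
  · rintro ⟨p, q, hpq, hs⟩
    exact (completePrism m).independenceComplex.down_closed (transversal p q)
      (pair_mem_faces_completePrism hpq (by simp)) s hs

theorem completePrism_isUnmixed (hm : 3 ≤ m) : (completePrism m).IsUnmixed := by
  have key : ∀ F, (completePrism m).independenceComplex.IsFacet F → F.card = 2 := by
    intro F hF
    obtain ⟨p, q, hpq, h⟩ := (mem_faces_completePrism_iff hm).1 hF.1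
    have := hF.2 ((mem_faces_completePrism_iff hm).2 ⟨p, q, hpq, subset_rfl⟩) h
    rw [h.antisymm this]
    exact Finset.card_pair (by simp)
  intro F F' hF hF'
  rw [key F hF, key F' hF']

/-- The link of `v` consists of points. Its faces are `∅`, enlarged in the deletion by `hne`, and
singletons `{w}`, enlarged to an edge `{u, w}` by `hext`; so `v` is a shedding vertex. -/
theorem vertexDecomposable_induced_of_erase {W : Finset (Fin m × Fin 2)} {v : Fin m × Fin 2}
    (hv : v ∈ W)
    (hW : ((completePrism m).independenceComplex.induced (W.erase v)).VertexDecomposable)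
    (hne : (W.erase v).Nonempty)
    (hext : ∀ w ∈ W, w.1 ≠ v.1 → w.2 ≠ v.2 → ∃ u ∈ W, u ≠ v ∧ u.1 ≠ w.1 ∧ u.2 ≠ w.2) :
    ((completePrism m).independenceComplex.induced W).VertexDecomposable := by
  set D := (completePrism m).independenceComplex
  have : Nonempty (Fin m × Fin 2) := ⟨v⟩
  have hsing : ∀ u, {u} ∈ D.faces := fun u => by simp [D, independenceComplex, IsIndepSet]
  have hvD : {v} ∈ (D.induced W).faces := ⟨hsing v, by simpa using hv⟩
  have hlink : (D.induced W).link v hvD =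
      FaceComplex.points (W.filter fun w => w.1 ≠ v.1 ∧ w.2 ≠ v.2) := by
    ext s
    simp only [FaceComplex.link, FaceComplex.points, FaceComplex.induced, Set.mem_ofPred_eq]
    constructor
    · rintro ⟨hvs, hs, hsW⟩
      have hopp : ∀ w ∈ s, w.1 ≠ v.1 ∧ w.2 ≠ v.2 := fun w hw =>
        ne_and_ne_of_mem_faces_completePrism hs (Finset.mem_insert_of_mem hw)
          (Finset.mem_insert_self _ _) (fun h => hvs (h ▸ hw))
      refine ⟨fun w hw => Finset.mem_filter.2 ⟨hsW (Finset.mem_insert_of_mem hw), hopp w hw⟩,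
        Finset.card_le_one.2 fun a ha b hb => ?_⟩
      by_contra hab
      have h := (ne_and_ne_of_mem_faces_completePrism hs (Finset.mem_insert_of_mem ha)
        (Finset.mem_insert_of_mem hb) hab).2
      have h1 := (hopp a ha).2
      have h2 := (hopp b hb).2
      -- `a`, `b` and `v` cannot lie in three different copies when there are only two.
      omega
    · rintro ⟨hs, hcard⟩
      have hopp : ∀ w ∈ s, w ∈ W ∧ w.1 ≠ v.1 ∧ w.2 ≠ v.2 := fun w hw =>
        Finset.mem_filter.1 (hs hw)
      refine ⟨fun h => (hopp v h).2.1 rfl, ?_, Finset.insert_subset hv fun w hw => (hopp w hw).1⟩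
      obtain ⟨w, hw⟩ := (Finset.card_le_one_iff_subset_singleton (s := s)).1 hcard
      rcases Finset.subset_singleton_iff.1 hw with rfl | rfl
      · simpa using hsing v
      · have := (hopp w (by simp)).2
        exact pair_mem_faces_completePrism this.1.symm this.2.symm
  refine .of_shedding _ v hvD ?_ ?_ ?_
  · rwa [FaceComplex.deletion_induced]
  · rw [hlink]
    exact FaceComplex.points_vertexDecomposable _
  · rw [hlink, FaceComplex.deletion_induced]
    rintro F ⟨hF, hcard⟩ hmax
    obtain ⟨w, hw⟩ := (Finset.card_le_one_iff_subset_singleton (s := F)).1 hcard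
    rcases Finset.subset_singleton_iff.1 hw with rfl | rfl
    · obtain ⟨u, hu⟩ := hne
      simpa using hmax.2 (y := {u}) ⟨hsing u, by simpa using hu⟩ (by simp)
        (Finset.mem_singleton_self u)
    · have hw' := Finset.mem_filter.1 (hF (Finset.mem_singleton_self w))
      obtain ⟨u, hu, huv, h1, h2⟩ := hext w hw'.1 hw'.2.1 hw'.2.2
      have hwv : w ≠ v := fun h => hw'.2.1 (h ▸ rfl)
      have := hmax.2 (y := {u, w}) ⟨pair_mem_faces_completePrism h1 h2, by
        simp [Finset.insert_subset_iff, hu, huv, hwv, hw'.1]⟩ (by simp)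
        (Finset.mem_insert_self u _)
      exact h1 (by rw [Finset.mem_singleton.1 this])

/-- The vertices of the prism lying over `X` in the first copy and over `Y` in the second. -/
def prismSet (X Y : Finset (Fin m)) : Finset (Fin m × Fin 2) := X ×ˢ {0} ∪ Y ×ˢ {1}

@[simp]
theorem mem_prismSet_zero {X Y : Finset (Fin m)} {a : Fin m} : (a, 0) ∈ prismSet X Y ↔ a ∈ X := by
  simp [prismSet]

@[simp]
theorem mem_prismSet_one {X Y : Finset (Fin m)} {a : Fin m} : (a, 1) ∈ prismSet X Y ↔ a ∈ Y := by
  simp [prismSet]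

theorem prismSet_erase_zero (X Y : Finset (Fin m)) (a : Fin m) :
    (prismSet X Y).erase (a, 0) = prismSet (X.erase a) Y := by
  ext ⟨b, i⟩
  fin_cases i <;> simp

theorem prismSet_erase_one (X Y : Finset (Fin m)) (a : Fin m) :
    (prismSet X Y).erase (a, 1) = prismSet X (Y.erase a) := by
  ext ⟨b, i⟩
  fin_cases i <;> simp

/-- Since `c` differs from `a` and `b`, the vertex `(c, 1)` stays joined to both remaining upper
vertices, so each other `(y, 1)` can be shed. Finally `(a, 0)` is shed, leaving the edge `{(b, 0),
(c, 1)}`. -/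
theorem vertexDecomposable_induced_pair {a b c : Fin m} (hab : a ≠ b) (hac : a ≠ c) (hbc : b ≠ c)
    (Y : Finset (Fin m)) (hcY : c ∉ Y) :
    ((completePrism m).independenceComplex.induced
      (prismSet {a, b} (insert c Y))).VertexDecomposable := by
  induction Y using Finset.induction_on with
  | empty =>
    refine vertexDecomposable_induced_of_erase (v := (a, 0)) (by simp) ?_ ⟨(b, 0), ?_⟩ ?_
    · rw [prismSet_erase_zero]
      refine .of_isSimplex _ ⟨{(b, 0), (c, 1)}, fun t => ?_⟩
      have : prismSet (({a, b} : Finset (Fin m)).erase a) (insert c ∅) = {(b, 0), (c, 1)} := by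
        ext ⟨x, i⟩
        fin_cases i
        · simp
          grind
        · simp
      rw [this]
      exact ⟨fun h => h.2, fun h => ⟨(completePrism m).independenceComplex.down_closed _
        (pair_mem_faces_completePrism (by simpa) (by simp)) _ h, h⟩⟩
    · simp [hab.symm]
    · rintro ⟨w, i⟩ hw h1 h2
      fin_cases i
      · simp at h2
      · refine ⟨(b, 0), by simp, by simp [hab.symm], ?_, by simp⟩
        simp at hw ⊢
        exact hw ▸ hbc
  | insert y Y hy ih =>
    have hcy : y ≠ c := fun h => hcY (h ▸ Finset.mem_insert_self _ _)
    refine vertexDecomposable_induced_of_erase (v := (y, 1)) (by simp) ?_ ⟨(a, 0), ?_⟩ ?_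
    · rw [prismSet_erase_one, Finset.erase_insert_of_ne hcy.symm, Finset.erase_insert hy]
      exact ih fun h => hcY (Finset.mem_insert_of_mem h)
    · simp
    · rintro ⟨w, i⟩ hw h1 h2
      fin_cases i
      · refine ⟨(c, 1), by simp, by simp [hcy.symm], ?_, by simp⟩
        simp at hw ⊢
        grind
      · simp at h2

/-- While `X` has at least three elements, removing `x` leaves for every `w` some `u ∈ X` other than
`x` and `w`, so `(x, 0)` can be shed. -/
theorem vertexDecomposable_induced_univ (hm : 3 ≤ m) (X : Finset (Fin m)) (hX : 2 ≤ X.card) :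
    ((completePrism m).independenceComplex.induced
      (prismSet X Finset.univ)).VertexDecomposable := by
  induction h : X.card using Nat.strong_induction_on generalizing X with
  | _ n ih =>
    rcases hX.eq_or_lt with h2 | h2
    · obtain ⟨a, b, hab, rfl⟩ := Finset.card_eq_two.1 h2.symm
      -- A third index exists because `3 ≤ m`.
      obtain ⟨c, hc⟩ := Finset.exists_mem_notMem_of_card_lt_card
        (s := ({a, b} : Finset (Fin m))) (t := Finset.univ) (by simp; omega)
      have hc' : a ≠ c ∧ b ≠ c := by simpa [eq_comm] using hc.2
      simpa using vertexDecomposable_induced_pair hab hc'.1 hc'.2 (Finset.univ.erase c) (by simp)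
    · obtain ⟨x, hx⟩ : X.Nonempty := Finset.card_pos.1 (by omega)
      have hcard := Finset.card_erase_of_mem hx
      refine vertexDecomposable_induced_of_erase (v := (x, 0)) (by simpa) ?_ ⟨(x, 1), by simp⟩ ?_
      · rw [prismSet_erase_zero]
        exact ih _ (by omega) _ (by omega) rfl
      · rintro ⟨w, i⟩ hw h1 h2
        fin_cases i
        · simp at h2
        · obtain ⟨u, hu⟩ : ((X.erase x).erase w).Nonempty := by
            have := Finset.pred_card_le_card_erase (s := X.erase x) (a := w)
            exact Finset.card_pos.1 (by omega)
          simp only [Finset.mem_erase] at hu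
          exact ⟨(u, 0), by simp [hu.2.2], by simp [hu.2.1], hu.1, by simp⟩

theorem completePrism_isVertexDecomposable (hm : 3 ≤ m) :
    (completePrism m).IsVertexDecomposable := by
  have h := vertexDecomposable_induced_univ hm Finset.univ (by simp; omega)
  have huniv : prismSet (Finset.univ : Finset (Fin m)) Finset.univ = Finset.univ := by
    ext ⟨a, i⟩
    fin_cases i <;> simp
  rwa [huniv, FaceComplex.induced_univ] at h

end SimpleGraph

/-! ### A Cohen–Macaulay criterion for integral extensions. -/

/-- By incomparability, a strict chain of primes contracts to a strict chain. -/
theorem Ideal.height_le_height_comap_of_isIntegral {A R : Type*} [CommRing A] [CommRing R]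
    [Algebra A R] [Algebra.IsIntegral A R] (P : Ideal R) [P.IsPrime] :
    P.height ≤ (P.comap (algebraMap A R)).height := by
  have hmono : StrictMono (PrimeSpectrum.comap (algebraMap A R)) := fun I J hIJ =>
    Ideal.IsIntegral.comap_lt_comap (show I.asIdeal < J.asIdeal from hIJ)
  have := Order.height_le_height_apply_of_strictMono _ hmono ⟨P, inferInstance⟩
  rwa [← PrimeSpectrum.height_eq_orderHeight, ← PrimeSpectrum.height_eq_orderHeight] at this

/-- Krull's principal ideal theorem bounds the height of `(s)` by one. -/
theorem Ideal.not_le_span_singleton_of_one_lt_height {A : Type*} [CommRing A]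
    [IsNoetherianRing A] {p : Ideal A} [p.IsPrime] (hp : 1 < p.height) {s : A} (hs : Prime s) :
    ¬ p ≤ Ideal.span {s} := by
  intro h
  have hprime : (Ideal.span {s}).IsPrime := (Ideal.span_singleton_prime hs.ne_zero).2 hs
  have h1 : (Ideal.span {s}).height ≤ 1 :=
    Ideal.height_le_one_of_isPrincipal_of_mem_minimalPrimes (Ideal.span {s}) _
      (by rw [Ideal.minimalPrimes_eq_subsingleton_self]; rfl)
  exact absurd (hp.trans_le ((Ideal.height_mono h).trans h1)) (lt_irrefl _)

theorem localRingDepth_le_ringKrullDim (R : Type*) [CommRing R] [IsLocalRing R]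
    [IsNoetherianRing R] : (localRingDepth R : WithBot ℕ∞) ≤ ringKrullDim R := by
  obtain ⟨d, hd⟩ : ∃ d : ℕ∞, ringKrullDim R = d :=
    ⟨_, (WithBot.coe_unbot _ (ringKrullDim_ne_bot (R := R))).symm⟩
  rw [hd, WithBot.coe_le_coe]
  refine sSup_le ?_
  rintro _ ⟨rs, -, hrs, rfl⟩
  have h := ringKrullDim_add_length_eq_ringKrullDim_of_isRegular rs hrs
  have hnt : Nontrivial (R ⧸ Ideal.ofList rs) :=
    Ideal.Quotient.nontrivial_iff.2 fun htop => hrs.top_ne_smul (by simp [htop])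
  rw [hd] at h
  rw [← WithBot.coe_le_coe, ← h]
  exact le_add_of_nonneg_left ringKrullDim_nonneg_of_nontrivial

theorem length_le_localRingDepth_localization {R : Type*} [CommRing R] (P : Ideal R) [P.IsPrime]
    {rs : List R} (hrs : RingTheory.Sequence.IsWeaklyRegular R rs) (hP : ∀ r ∈ rs, r ∈ P) :
    (rs.length : ℕ∞) ≤ localRingDepth (Localization.AtPrime P) := by
  refine le_sSup ⟨rs.map (algebraMap R _), ?_,
    hrs.isRegular_of_isLocalization_of_mem (Localization.AtPrime P) P hP, by simp⟩
  intro r hr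
  obtain ⟨x, hx, rfl⟩ := List.mem_map.1 hr
  exact (IsLocalization.AtPrime.to_map_mem_maximal_iff _ P x).2 (hP x hx)

open RingTheory.Sequence in
/-- A criterion for an integral extension `R` of a two-dimensional factorial domain `A` to be
Cohen–Macaulay, in terms of regular sequences `f, g` in `A` where `f` is a prime element outside
two given prime elements. -/
theorem isCohenMacaulayRing_of_isIntegral {A R : Type*} [CommRing A] [IsDomain A]
    [UniqueFactorizationMonoid A] [IsNoetherianRing A] [CommRing R] [IsNoetherianRing R]
    [Algebra A R] [Algebra.IsIntegral A R] (hdim : ringKrullDim A ≤ 2)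
    {s t : A} (hs : Prime s) (ht : Prime t)
    (hreg : ∀ f : A, f ≠ 0 → IsSMulRegular R (algebraMap A R f))
    (hdvd : ∀ f g : A, Prime f → ¬ s ∣ f → ¬ t ∣ f → ¬ f ∣ g → ∀ r r' : R,
      algebraMap A R g * r = algebraMap A R f * r' → ∃ q, r = algebraMap A R f * q) :
    IsCohenMacaulayRing R := by
  refine ⟨inferInstance, fun P _ => le_antisymm (localRingDepth_le_ringKrullDim _) ?_⟩
  rw [IsLocalization.AtPrime.ringKrullDim_eq_height P, WithBot.coe_le_coe]
  set p := P.comap (algebraMap A R) with hp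
  refine (Ideal.height_le_height_comap_of_isIntegral (A := A) P).trans ?_
  rw [← hp]
  have hle : p.height ≤ 2 := by
    have := (Ideal.height_le_ringKrullDim_of_ne_top (I := p) (Ideal.IsPrime.ne_top')).trans hdim
    rwa [← WithBot.coe_le_coe]
  rcases eq_or_ne p ⊥ with h0 | h0
  · simp [h0]
  rcases le_or_gt p.height 1 with h1 | h1
  · obtain ⟨f, hf, hf0⟩ := Submodule.exists_mem_ne_zero_of_ne_bot h0
    refine h1.trans ?_
    simpa using length_le_localRingDepth_localization P (rs := [algebraMap A R f])
      ((isWeaklyRegular_singleton_iff _ _).2 (hreg f hf0)) (by simpa using Ideal.mem_comap.1 hf)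
  -- Prime avoidance gives `x ∈ p` outside `(s)` and `(t)`; some prime factor of `x` lies in `p` and
  -- inherits both non-divisibilities.
  obtain ⟨f, hf, hfp, hsf, htf⟩ : ∃ f, Prime f ∧ f ∈ p ∧ ¬ s ∣ f ∧ ¬ t ∣ f := by
    have hnot : ¬ (p : Set A) ⊆ Ideal.span {s} ∪ Ideal.span {t} := by
      rw [Ideal.subset_union]
      rintro (h | h)
      · exact Ideal.not_le_span_singleton_of_one_lt_height h1 hs h
      · exact Ideal.not_le_span_singleton_of_one_lt_height h1 ht h
    obtain ⟨x, hxp, hx⟩ := Set.not_subset.1 hnot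
    simp only [Set.mem_union, SetLike.mem_coe, Ideal.mem_span_singleton, not_or] at hx
    have hx0 : x ≠ 0 := fun h => hx.1 (h ▸ dvd_zero s)
    obtain ⟨F, hF, u, rfl⟩ := UniqueFactorizationMonoid.exists_prime_factors x hx0
    have hFp : F.prod ∈ p := by
      rwa [SetLike.mem_coe, Ideal.mul_unit_mem_iff_mem _ u.isUnit] at hxp
    obtain ⟨f, hfF, hfp⟩ := (Ideal.IsPrime.multiset_prod_mem_iff_exists_mem inferInstance F).1 hFp
    have hfdvd := (Multiset.dvd_prod hfF).mul_right (u : A)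
    exact ⟨f, hF f hfF, hfp, fun h => hx.1 (h.trans hfdvd), fun h => hx.2 (h.trans hfdvd)⟩
  obtain ⟨g, hgp, hg⟩ := SetLike.not_le_iff_exists.1
    (Ideal.not_le_span_singleton_of_one_lt_height h1 hf)
  rw [Ideal.mem_span_singleton] at hg
  refine hle.trans ?_
  refine (length_le_localRingDepth_localization P
    (rs := [algebraMap A R f, algebraMap A R g]) ?_ (by simpa using ⟨hfp, hgp⟩))
  -- `hdvd` says exactly that `g` is a nonzerodivisor on `R / fR`.
  refine .cons (hreg f hf.ne_zero) ((isWeaklyRegular_singleton_iff _ _).2 ?_)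
  rw [isSMulRegular_iff_right_eq_zero_of_smul]
  intro x hx
  obtain ⟨r, rfl⟩ := Submodule.Quotient.mk_surjective _ x
  rw [← Submodule.Quotient.mk_smul, Submodule.Quotient.mk_eq_zero,
    Submodule.mem_smul_pointwise_iff_exists] at hx
  obtain ⟨r', -, hr'⟩ := hx
  obtain ⟨q, hq⟩ := hdvd f g hf hsf htf hg r r' hr'.symm
  rw [Submodule.Quotient.mk_eq_zero, Submodule.mem_smul_pointwise_iff_exists]
  exact ⟨q, trivial, hq.symm⟩

/-! ### The Stanley–Reisner ring of the prism's complex. -/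

namespace SimpleGraph

open MvPolynomial FaceComplex

variable {m : ℕ} {k : Type*} [Field k]

theorem transversal_injective (p q : Fin m) :
    Function.Injective fun i : Fin 2 => ((![p, q] i, i) : Fin m × Fin 2) :=
  fun _ _ h => (Prod.mk.inj h).2

/-- Restriction of polynomials to the coordinate plane of the facet `{(p, 0), (q, 1)}`. -/
noncomputable def restrict (k : Type*) [Field k] (p q : Fin m) :
    MvPolynomial (Fin m × Fin 2) k →ₐ[k] MvPolynomial (Fin 2) k :=
  killCompl (transversal_injective p q)

theorem restrict_X_zero (p q i : Fin m) :
    restrict k p q (X (i, 0)) = if i = p then X 0 else 0 := by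
  split_ifs with h
  · subst h
    simpa [restrict] using killCompl_rename_app (transversal_injective i q) (X 0 : MvPolynomial (Fin 2) k)
  · rw [restrict, killCompl, aeval_X, dif_neg]
    rintro ⟨j, hj⟩
    simp only [Prod.mk.injEq] at hj
    obtain ⟨hj, rfl⟩ := hj
    exact h hj.symm

theorem restrict_X_one (p q i : Fin m) :
    restrict k p q (X (i, 1)) = if i = q then X 1 else 0 := by
  split_ifs with h
  · subst h
    simpa [restrict] using killCompl_rename_app (transversal_injective p i) (X 1 : MvPolynomial (Fin 2) k)
  · rw [restrict, killCompl, aeval_X, dif_neg]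
    rintro ⟨j, hj⟩
    simp only [Prod.mk.injEq] at hj
    obtain ⟨hj, rfl⟩ := hj
    exact h hj.symm

theorem range_transversal (p q : Fin m) :
    Set.range (fun i : Fin 2 => ((![p, q] i, i) : Fin m × Fin 2)) = transversal p q := by
  ext ⟨a, i⟩
  fin_cases i <;> simp [transversal, eq_comm]

/-- The ideal is the intersection of the primes of the facets, each the kernel of a restriction. -/
theorem mem_stanleyReisnerIdeal_completePrism_iff (hm : 3 ≤ m)
    {f : MvPolynomial (Fin m × Fin 2) k} :
    f ∈ (completePrism m).independenceComplex.stanleyReisnerIdeal k ↔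
      ∀ p q, p ≠ q → restrict k p q f = 0 := by
  set D := (completePrism m).independenceComplex
  constructor
  · intro hf p q hpq
    suffices D.stanleyReisnerIdeal k ≤ RingHom.ker (restrict k p q) from this hf
    refine Ideal.span_le.2 ?_
    rintro _ ⟨s, hs, rfl⟩
    obtain ⟨v, hv, hvF⟩ : ∃ v ∈ s, v ∉ transversal p q := by
      by_contra! h
      exact hs ((mem_faces_completePrism_iff hm).2 ⟨p, q, hpq, h⟩)
    rw [SetLike.mem_coe, RingHom.mem_ker, map_prod]
    refine Finset.prod_eq_zero hv ?_
    rw [restrict, killCompl, aeval_X, dif_neg]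
    rwa [range_transversal]
  · intro hf
    have hspan : D.stanleyReisnerIdeal k = Ideal.span ((fun d => monomial d (1 : k)) ''
        {d | ∃ s : Finset (Fin m × Fin 2), s ∉ D.faces ∧
          d = ∑ i ∈ s, Finsupp.single i 1}) := by
      refine congrArg Ideal.span ?_
      ext g
      simp only [Set.mem_ofPred_eq, Set.mem_image]
      constructor
      · rintro ⟨s, hs, rfl⟩
        exact ⟨_, ⟨s, hs, rfl⟩, by rw [monomial_sum_one]; rfl⟩
      · rintro ⟨_, ⟨s, hs, rfl⟩, rfl⟩
        exact ⟨s, hs, by rw [monomial_sum_one]; rfl⟩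
    rw [hspan, mem_ideal_span_monomial_image]
    intro d hd
    -- Were the support of `d` a face, restricting to a facet containing it would preserve the
    -- nonzero coefficient of `d`.
    refine ⟨_, ⟨d.support, fun hface => ?_, rfl⟩, ?_⟩
    · obtain ⟨p, q, hpq, hsub⟩ := (mem_faces_completePrism_iff hm).1 hface
      have hinj := transversal_injective p q
      have h := coeff_killCompl (R := k) (p := f) hinj (s := d.comapDomain _ hinj.injOn)
      rw [Finsupp.mapDomain_comapDomain _ hinj d (by rw [range_transversal]; exact_mod_cast hsub),
        ← restrict, hf p q hpq, coeff_zero] at h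
      exact mem_support_iff.1 hd h.symm
    · intro v
      rw [Finsupp.finsetSum_apply]
      simp only [Finsupp.single_apply, Finset.sum_ite_eq', Finsupp.mem_support_iff]
      split_ifs <;> omega

/-- The sums of the variables over the two copies of `K_m`, as a map from `k[s, t]`. -/
noncomputable def colorSum (m : ℕ) (k : Type*) [Field k] :
    MvPolynomial (Fin 2) k →ₐ[k] MvPolynomial (Fin m × Fin 2) k :=
  aeval fun i => ∑ a, X (a, i)

/-- Hence `k[s, t]` acts on every facet component by ordinary multiplication, which reduces
divisibility questions to `k[s, t]`. -/
theorem restrict_colorSum (p q : Fin m) (f : MvPolynomial (Fin 2) k) :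
    restrict k p q (colorSum m k f) = f := by
  suffices (restrict k p q).comp (colorSum m k) = AlgHom.id k _ from DFunLike.congr_fun this f
  ext i : 1
  fin_cases i <;> simp [colorSum, restrict_X_zero, restrict_X_one]

theorem aeval_eq_of_dvd_sub {B : Type*} [CommRing B] [Algebra k B] {i : Fin 2} {v : Fin 2 → B}
    (hv : v i = 0) {f g : MvPolynomial (Fin 2) k} (h : X i ∣ f - g) :
    aeval v f = aeval v g := by
  obtain ⟨c, hc⟩ := h
  rw [← sub_eq_zero, ← map_sub, hc, map_mul, aeval_X, hv, zero_mul]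

/-- A family of polynomials on the facets of the prism's independence complex, compatible along
the vertices, comes from a single polynomial. -/
theorem exists_restrict_eq (hm : 3 ≤ m) (F : Fin m → Fin m → MvPolynomial (Fin 2) k)
    (h0 : ∀ p q q', p ≠ q → p ≠ q' → X 1 ∣ F p q - F p q')
    (h1 : ∀ p p' q, p ≠ q → p' ≠ q → X 0 ∣ F p q - F p' q) :
    ∃ f : MvPolynomial (Fin m × Fin 2) k, ∀ p q, p ≠ q → restrict k p q f = F p q := by
  have : Nontrivial (Fin m) := Fin.nontrivial_iff_two_le.2 (by omega)
  obtain ⟨o, ho⟩ : ∃ o : Fin m → Fin m, ∀ a, o a ≠ a :=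
    ⟨fun a => (exists_ne a).choose, fun a => (exists_ne a).choose_spec⟩
  have hrow : ∀ p q q', p ≠ q → p ≠ q' → constantCoeff (F p q) = constantCoeff (F p q') := by
    intro p q q' h h'
    obtain ⟨c, hc⟩ := h0 p q q' h h'
    rw [← sub_eq_zero, ← map_sub, hc]
    simp
  have hcol : ∀ p p' q, p ≠ q → p' ≠ q → constantCoeff (F p q) = constantCoeff (F p' q) := by
    intro p p' q h h'
    obtain ⟨c, hc⟩ := h1 p p' q h h'
    rw [← sub_eq_zero, ← map_sub, hc]
    simp
  -- The complex is connected: the index `x`, distinct from `p` and `a`, gives a path of facets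
  -- between `(p, q)` and `(a, o a)`.
  obtain ⟨c, hc⟩ : ∃ c : k, ∀ p q, p ≠ q → constantCoeff (F p q) = c := by
    have key : ∀ p q p' q', p ≠ q → p' ≠ q' → p ≠ q' →
        constantCoeff (F p q) = constantCoeff (F p' q') := fun p q p' q' h h' hpq' =>
      (hrow p q q' h hpq').trans (hcol p p' q' hpq' h')
    let a : Fin m := ⟨0, by omega⟩
    refine ⟨constantCoeff (F a (o a)), fun p q hpq => ?_⟩
    obtain ⟨x, hx⟩ : ∃ x : Fin m, x ∉ ({p, a} : Finset (Fin m)) := by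
      by_contra! h
      have h1 : (Finset.univ : Finset (Fin m)).card ≤ ({p, a} : Finset (Fin m)).card :=
        Finset.card_le_card fun x _ => h x
      have h2 : ({p, a} : Finset (Fin m)).card ≤ 2 := Finset.card_le_two
      simp at h1
      omega
    simp only [Finset.mem_insert, Finset.mem_singleton, not_or] at hx
    have hax : a ≠ x := fun h => hx.2 h.symm
    have hpx : p ≠ x := fun h => hx.1 h.symm
    exact (key p q a x hpq hax hpx).trans (hrow _ _ _ hax (ho a).symm)
  have hzero : ∀ p q, p ≠ q → aeval ![0, 0] (F p q) = (C c : MvPolynomial (Fin 2) k) := by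
    intro p q hpq
    have : (![0, 0] : Fin 2 → MvPolynomial (Fin 2) k) = 0 := by
      ext i : 1
      fin_cases i <;> rfl
    rw [this, aeval_zero, hc p q hpq]
    rfl
  let x (i : Fin m) : MvPolynomial (Fin m × Fin 2) k := X (i, 0)
  let y (i : Fin m) : MvPolynomial (Fin m × Fin 2) k := X (i, 1)
  -- Inclusion–exclusion over the empty face, the vertices and the edges. By compatibility, the
  -- choice of neighbour `o i` does not affect the vertex terms.
  let f : MvPolynomial (Fin m × Fin 2) k := C c
    + ∑ i, (aeval ![x i, 0] (F i (o i)) - C c)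
    + ∑ j, (aeval ![0, y j] (F (o j) j) - C c)
    + ∑ i, ∑ j, if i = j then 0 else
        aeval ![x i, y j] (F i j) - aeval ![x i, 0] (F i j) - aeval ![0, y j] (F i j) + C c
  refine ⟨f, fun p q hpq => ?_⟩
  set r := restrict k p q
  have hC : ∀ a : k, r (C a) = C a := fun a => AlgHom.commutes r a
  have hcomp : ∀ u v (g : MvPolynomial (Fin 2) k), r (aeval ![u, v] g) = aeval ![r u, r v] g := by
    intro u v g
    suffices r.comp (aeval ![u, v]) = aeval ![r u, r v] from DFunLike.congr_fun this g
    ext i : 1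
    fin_cases i <;> simp
  have hx : ∀ i, r (x i) = if i = p then X 0 else 0 := restrict_X_zero p q
  have hy : ∀ i, r (y i) = if i = q then X 1 else 0 := restrict_X_one p q
  have hid : aeval ![X 0, X 1] (F p q) = F p q := by
    have : (![X 0, X 1] : Fin 2 → MvPolynomial (Fin 2) k) = X := by
      ext i : 1
      fin_cases i <;> rfl
    rw [this, aeval_X_left_apply]
  have e1 : ∑ i, (aeval ![r (x i), 0] (F i (o i)) - C c) =
      aeval ![X 0, 0] (F p q) - (C c : MvPolynomial (Fin 2) k) := by
    rw [Finset.sum_eq_single p]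
    · rw [hx, if_pos rfl, aeval_eq_of_dvd_sub (i := 1) rfl (h0 p (o p) q (ho p).symm hpq)]
    · intro i _ hi
      rw [hx, if_neg hi, hzero _ _ (ho i).symm, sub_self]
    · simp
  have e2 : ∑ j, (aeval ![0, r (y j)] (F (o j) j) - C c) =
      aeval ![0, X 1] (F p q) - (C c : MvPolynomial (Fin 2) k) := by
    rw [Finset.sum_eq_single q]
    · rw [hy, if_pos rfl, aeval_eq_of_dvd_sub (i := 0) rfl (h1 (o q) p q (ho q) hpq)]
    · intro i _ hi
      rw [hy, if_neg hi, hzero _ _ (ho i), sub_self]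
    · simp
  have e3 : (∑ i, ∑ j, if i = j then 0 else
      aeval ![r (x i), r (y j)] (F i j) - aeval ![r (x i), 0] (F i j)
        - aeval ![0, r (y j)] (F i j) + C c) =
      F p q - aeval ![X 0, 0] (F p q) - aeval ![0, X 1] (F p q)
        + (C c : MvPolynomial (Fin 2) k) := by
    rw [Finset.sum_eq_single p, Finset.sum_eq_single q]
    · rw [if_neg hpq, hx, hy, if_pos rfl, if_pos rfl, hid]
    · intro j _ hj
      split_ifs with h
      · rfl
      · rw [hy, if_neg hj, hzero _ _ h]
        ring
    · simp
    · intro i _ hi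
      refine Finset.sum_eq_zero fun j _ => ?_
      split_ifs with h
      · rfl
      · rw [hx, if_neg hi, hzero _ _ h]
        ring
    · simp
  simp only [f, map_add, map_sub, map_sum, apply_ite r, map_zero, hC, hcomp]
  rw [e1, e2, e3]
  ring

theorem dvd_restrict_sub_zero (p q q' : Fin m) (f : MvPolynomial (Fin m × Fin 2) k) :
    X 1 ∣ restrict k p q f - restrict k p q' f := by
  rw [← Ideal.mem_span_singleton, ← Ideal.Quotient.mk_eq_mk_iff_sub_mem]
  let π := Ideal.Quotient.mkₐ k (Ideal.span {(X 1 : MvPolynomial (Fin 2) k)})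
  have hπ : π (X 1) = 0 := Ideal.Quotient.eq_zero_iff_mem.2 (Ideal.mem_span_singleton_self _)
  suffices π.comp (restrict k p q) = π.comp (restrict k p q') from DFunLike.congr_fun this f
  ext ⟨a, i⟩ : 1
  fin_cases i
  · simp [restrict_X_zero]
  · simp [restrict_X_one, apply_ite π, hπ]

theorem dvd_restrict_sub_one (p p' q : Fin m) (f : MvPolynomial (Fin m × Fin 2) k) :
    X 0 ∣ restrict k p q f - restrict k p' q f := by
  rw [← Ideal.mem_span_singleton, ← Ideal.Quotient.mk_eq_mk_iff_sub_mem]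
  let π := Ideal.Quotient.mkₐ k (Ideal.span {(X 0 : MvPolynomial (Fin 2) k)})
  have hπ : π (X 0) = 0 := Ideal.Quotient.eq_zero_iff_mem.2 (Ideal.mem_span_singleton_self _)
  suffices π.comp (restrict k p q) = π.comp (restrict k p' q) from DFunLike.congr_fun this f
  ext ⟨a, i⟩ : 1
  fin_cases i
  · simp [restrict_X_zero, apply_ite π, hπ]
  · simp [restrict_X_one]

theorem completePrism_isCohenMacaulay (hm : 3 ≤ m) (k : Type*) [Field k] :
    (completePrism m).IsCohenMacaulay k := by
  set I := (completePrism m).independenceComplex.stanleyReisnerIdeal k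
  have hI {f : MvPolynomial (Fin m × Fin 2) k} : f ∈ I ↔ ∀ p q, p ≠ q → restrict k p q f = 0 :=
    mem_stanleyReisnerIdeal_completePrism_iff hm
  let φ := (Ideal.Quotient.mk I).comp (colorSum m k).toRingHom
  let _ : Algebra (MvPolynomial (Fin 2) k) (MvPolynomial (Fin m × Fin 2) k ⧸ I) := φ.toAlgebra
  have hφ (f) : algebraMap (MvPolynomial (Fin 2) k) (MvPolynomial (Fin m × Fin 2) k ⧸ I) f =
    Ideal.Quotient.mk I (colorSum m k f) := rfl
  have hint : Algebra.IsIntegral (MvPolynomial (Fin 2) k)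
      (MvPolynomial (Fin m × Fin 2) k ⧸ I) := by
    refine ⟨fun r => ?_⟩
    obtain ⟨f, rfl⟩ := Ideal.Quotient.mk_surjective r
    induction f using MvPolynomial.induction_on with
    | C a =>
      have : Ideal.Quotient.mk I (C a) =
          algebraMap (MvPolynomial (Fin 2) k) (MvPolynomial (Fin m × Fin 2) k ⧸ I) (C a) := by
        rw [hφ]
        exact congrArg _ ((colorSum m k).commutes a).symm
      rw [this]
      exact isIntegral_algebraMap
    | add f g hf hg => rw [map_add]; exact hf.add hg
    | mul_X f v hf =>
      rw [map_mul]
      refine hf.mul ?_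
      obtain ⟨a, i⟩ := v
      -- On each facet the variable restricts to `0` or to `X i`, both roots of `T ^ 2 - X i * T`.
      refine ⟨Polynomial.X ^ 2 - Polynomial.C (X i) * Polynomial.X,
        by monicity!, ?_⟩
      simp only [Polynomial.eval₂_sub, Polynomial.eval₂_mul, Polynomial.eval₂_pow,
        Polynomial.eval₂_X, Polynomial.eval₂_C, hφ]
      rw [← map_pow, ← map_mul, ← map_sub, Ideal.Quotient.eq_zero_iff_mem, hI]
      intro p q hpq
      rw [map_sub, map_mul, restrict_colorSum, map_pow]
      fin_cases i
      · simp only [Fin.zero_eta, restrict_X_zero]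
        split_ifs <;> ring
      · simp only [Fin.mk_one, restrict_X_one]
        split_ifs <;> ring
  have hprime (i : Fin 2) : Prime (X i : MvPolynomial (Fin 2) k) := X_prime
  refine isCohenMacaulayRing_of_isIntegral (A := MvPolynomial (Fin 2) k) ?_
    (hprime 0) (hprime 1) ?_ ?_
  · rw [MvPolynomial.ringKrullDim_of_isNoetherianRing]
    simp
  · intro f hf
    rw [isSMulRegular_iff_right_eq_zero_of_smul]
    intro x hx
    obtain ⟨g, rfl⟩ := Ideal.Quotient.mk_surjective x
    rw [smul_eq_mul, hφ, ← map_mul, Ideal.Quotient.eq_zero_iff_mem, hI] at hx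
    rw [Ideal.Quotient.eq_zero_iff_mem, hI]
    intro p q hpq
    have := hx p q hpq
    rw [map_mul, restrict_colorSum] at this
    exact (mul_eq_zero.1 this).resolve_left hf
  · intro f g hf hsf htf hfg r r' h
    obtain ⟨r, rfl⟩ := Ideal.Quotient.mk_surjective r
    obtain ⟨r', rfl⟩ := Ideal.Quotient.mk_surjective r'
    rw [hφ, hφ, ← map_mul, ← map_mul, Ideal.Quotient.mk_eq_mk_iff_sub_mem, hI] at h
    -- On each facet `g * r = f * r'` in `k[s, t]`, and the prime `f` does not divide `g`.
    have hdiv (p q) (hpq : p ≠ q) : f ∣ restrict k p q r := by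
      have := h p q hpq
      rw [map_sub, map_mul, map_mul, restrict_colorSum, restrict_colorSum, sub_eq_zero] at this
      exact (hf.dvd_or_dvd (Dvd.intro _ this.symm)).resolve_left hfg
    choose! F hF using hdiv
    -- The quotients by `f` remain compatible along vertices because the prime `X i` does not divide
    -- `f`; they therefore glue to `u`.
    have hcancel {i : Fin 2} (hi : ¬ X i ∣ f) {p q p' q' : Fin m} (hpq : p ≠ q) (hpq' : p' ≠ q')
        (hd : X i ∣ restrict k p q r - restrict k p' q' r) : X i ∣ F p q - F p' q' := by
      rw [hF p q hpq, hF p' q' hpq', ← mul_sub] at hd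
      exact ((hprime i).dvd_or_dvd hd).resolve_left hi
    obtain ⟨u, hu⟩ := exists_restrict_eq hm F
      (fun p q q' hq hq' => hcancel htf hq hq' (dvd_restrict_sub_zero p q q' r))
      (fun p p' q hq hq' => hcancel hsf hq hq' (dvd_restrict_sub_one p p' q r))
    refine ⟨Ideal.Quotient.mk I u, ?_⟩
    rw [hφ, ← map_mul, Ideal.Quotient.mk_eq_mk_iff_sub_mem, hI]
    intro p q hpq
    rw [map_sub, map_mul, restrict_colorSum, hu p q hpq, hF p q hpq, sub_self]

end SimpleGraph

theorem proposition2p8 (m : ℕ) (hm : 3 ≤ m) :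
    (SimpleGraph.completeGraph (Fin m) □ SimpleGraph.completeGraph (Fin 2)).IsUnmixed ∧
    (SimpleGraph.completeGraph (Fin m) □ SimpleGraph.completeGraph (Fin 2)).IsVertexDecomposable ∧
    ∀ (k : Type*) [Field k],
      (SimpleGraph.completeGraph (Fin m) □ SimpleGraph.completeGraph (Fin 2)).IsCohenMacaulay k :=
  ⟨SimpleGraph.completePrism_isUnmixed hm, SimpleGraph.completePrism_isVertexDecomposable hm,
    fun k _ => SimpleGraph.completePrism_isCohenMacaulay hm k⟩
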